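/- Let $X$ be a super-reflexive (real) Banach space, i.e. every Banach space finitely representable in $X$ is reflexive. Let $r_k(t)=\operatorname{sign}\sin(2^k\pi t)$, $k\ge 1$, be the Rademacher functions. A nonnegative nondecreasing function $\varphi:[0,1]\to\mathbb R$ is a (generalized) cotype of $X$ if there are $a,b>0$ such that $\sum_{k=1}^n\varphi(\|x_k\|)\le b$ for all finite families $x_1,\dots,x_n\in X$ with $\|x_k\|\le 1$ for all $k$ and $\int_0^1\|\sum_{k=1}^n r_k(t)x_k\|\,dt\le a$; it is normalized if this holds with $a=b=1$. For real functions on $(0,1]$ write $\varphi\preceq\psi$ if there is $c>0$ with $\varphi(t)\le c\,\psi(t)$ for all $t\in(0,1]$. Then there is a function $\mathfrak Q_X:(0,1]\to(0,\infty)$ that is decreasing (not necessarily strictly) and submultiplicative, i.e. $\mathfrak Q_X(st)\le\mathfrak Q_X(s)\mathfrak Q_X(t)$ for $s,t\in(0,1]$ (in particular $\mathfrak Q_X\ge1$), such that: 1. for every $t\in(0,1]$, $\ \sup\{\varphi(t):\varphi\text{ is a convex normalized cotype of }X\}\le(\mathfrak Q_X(t)-1)^{-1}$, where $0^{-1}=\infty$;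 2. for every $\varepsilon\in(0,1]$, the function $\varphi_\varepsilon$ on $[0,1]$ with $\varphi_\varepsilon(t)=\mathfrak Q_X(\varepsilon)^{-1}$ for $t\ge\varepsilon$ and $\varphi_\varepsilon(t)=0$ for $t<\varepsilon$ is a normalized cotype of $X$; 3. $\mathfrak Q_X^{-1}$ is the supremum with respect to $\preceq$ of the set of all cotypes of $X$ defined on $[0,1]$: every such cotype $\varphi$ satisfies $\varphi\preceq\mathfrak Q_X^{-1}$, and if $\chi:(0,1]\to\mathbb R$ satisfies $\varphi\preceq\chi$ for every such cotype $\varphi$, then $\mathfrak Q_X^{-1}\preceq\chi$. -/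

import Mathlib

open Set

noncomputable section

universe u v

/-- A normed space is reflexive when its canonical map into the topological bidual is onto. -/
def IsReflexiveSpace (Y : Type u) [NormedAddCommGroup Y] [NormedSpace ℝ Y] : Prop :=
  Function.Surjective (NormedSpace.inclusionInDoubleDual ℝ Y)

/-- `Y` is finitely representable in `X`: every finite-dimensional subspace of `Y` embeds
linearly into `X` with distortion at most `1 + ε`, for every `ε > 0`. -/
def FinitelyRepresentable (Y : Type u) [NormedAddCommGroup Y] [NormedSpace ℝ Y]
    (X : Type v) [NormedAddCommGroup X] [NormedSpace ℝ X] : Prop :=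
  ∀ E : Submodule ℝ Y, FiniteDimensional ℝ E → ∀ ε : ℝ, 0 < ε →
    ∃ T : E →ₗ[ℝ] X, ∀ e : E, ‖e‖ ≤ ‖T e‖ ∧ ‖T e‖ ≤ (1 + ε) * ‖e‖

/-- `X` is super-reflexive: every Banach space finitely representable in `X` is reflexive.
Reflexivity is decided by separable subspaces, so spaces in the universe of `X` suffice. -/
def SuperReflexive (X : Type u) [NormedAddCommGroup X] [NormedSpace ℝ X] : Prop :=
  ∀ (Y : Type u) [NormedAddCommGroup Y] [NormedSpace ℝ Y] [CompleteSpace Y],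
    FinitelyRepresentable Y X → IsReflexiveSpace Y

/-- The Rademacher functions `sign (sin (2 ^ k * π * t))`, `k ≥ 1`, with the index shifted to
start at `0`. -/
def rademacher (k : ℕ) (t : ℝ) : ℝ :=
  Real.sign (Real.sin (2 ^ (k + 1) * Real.pi * t))

/-- The Rademacher average `∫₀¹ ‖∑ₖ rₖ(t) xₖ‖ dt` of finitely many vectors. -/
def rademacherAverage {X : Type u} [NormedAddCommGroup X] [NormedSpace ℝ X] {n : ℕ}
    (x : Fin n → X) : ℝ :=
  ∫ t in (0 : ℝ)..1, ‖∑ k : Fin n, rademacher k t • x k‖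

/-- `φ` is a generalized cotype of `X` defined on `[0,1]`. Only the values of `φ` on `[0,1]`
matter, hence only vectors of norm at most `1` are tested. -/
def IsCotype (X : Type u) [NormedAddCommGroup X] [NormedSpace ℝ X] (φ : ℝ → ℝ) : Prop :=
  (∀ t ∈ Icc (0 : ℝ) 1, 0 ≤ φ t) ∧ MonotoneOn φ (Icc 0 1) ∧
    ∃ a b : ℝ, 0 < a ∧ 0 < b ∧ ∀ (n : ℕ) (x : Fin n → X), (∀ k, ‖x k‖ ≤ 1) →
      rademacherAverage x ≤ a → ∑ k, φ ‖x k‖ ≤ b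

/-- A normalized cotype. Here `rademacherAverage x ≤ 1` already forces `‖x k‖ ≤ 1` for all `k`. -/
def IsNormalizedCotype (X : Type u) [NormedAddCommGroup X] [NormedSpace ℝ X]
    (φ : ℝ → ℝ) : Prop :=
  IsCotype X φ ∧ ∀ (n : ℕ) (x : Fin n → X), rademacherAverage x ≤ 1 → ∑ k, φ ‖x k‖ ≤ 1

/-- The order `φ ≼ ψ` between functions on `(0,1]`. -/
def Preceq (φ ψ : ℝ → ℝ) : Prop :=
  ∃ c : ℝ, 0 < c ∧ ∀ t ∈ Ioc (0 : ℝ) 1, φ t ≤ c * ψ t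

/-- `ψ` is a supremum (least upper bound) of the set `S` for the order `≼`. -/
def IsPreceqSup (S : Set (ℝ → ℝ)) (ψ : ℝ → ℝ) : Prop :=
  (∀ φ ∈ S, Preceq φ ψ) ∧ ∀ χ : ℝ → ℝ, (∀ φ ∈ S, Preceq φ χ) → Preceq ψ χ

end

/-! Rademacher averages equal finite sign averages. `signPackingNumber X ε` is the function sought:
the least `n` for which no `ℓ¹(Ω; X)`, `Ω` finite, contains `n` vectors of norm at least `ε` with
sign average at most `1`. Passing from `X` to `ℓ¹(Ω; X)` absorbs block sums with random signs, which
gives submultiplicativity (`SignPackable.of_prod`), while Jensen's inequality keeps convex cotypes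
under control (`SignPackable.card_mul_le_one`).

Finiteness is where super-reflexivity enters. If arbitrarily large packings exist at one `ε`,
submultiplicativity pushes `ε` up to every `δ < 1`; averaging over `Ω` then yields vectors of `X`
itself, which span almost isometric copies of `ℓ^∞_n` (`exists_supNorm_embedding`). So `c₀` is
finitely representable in `X`, though it is not reflexive.

For the supremum, any cotype is compared at `ε` with a truncated affine convex cotype
(`SignPackable.card_mul_le`), and submultiplicativity absorbs the change of scale. Conversely,
geometric series of step cotypes show that no smaller bound works. -/

open scoped BigOperators

/-! ### Averages over signs and the contraction principle. -/

/-- The signed sum `∑ σᵢ xᵢ`. -/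
def signSum {ι X : Type*} [Fintype ι] [NormedAddCommGroup X] [NormedSpace ℝ X]
    (x : ι → X) (σ : ι → ℤˣ) : X :=
  ∑ i, ((σ i : ℤ) : ℝ) • x i

/-- The average of `‖∑ σᵢ xᵢ‖` over all choices of signs. -/
noncomputable def signAverage {ι X : Type*} [Fintype ι] [DecidableEq ι] [NormedAddCommGroup X]
    [NormedSpace ℝ X] (x : ι → X) : ℝ :=
  𝔼 σ : ι → ℤˣ, ‖signSum x σ‖

section SignAverage

variable {ι κ X : Type*} [Fintype ι] [Fintype κ] [NormedAddCommGroup X] [NormedSpace ℝ X]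

theorem signSum_smul (c : ℝ) (x : ι → X) (σ : ι → ℤˣ) :
    signSum (fun i => c • x i) σ = c • signSum x σ := by
  simp only [signSum, Finset.smul_sum]
  exact Finset.sum_congr rfl fun i _ => smul_comm _ _ _

theorem convexOn_norm_sum_smul (x : ι → X) : ConvexOn ℝ univ fun a : ι → ℝ => ‖∑ i, a i • x i‖ := by
  refine ⟨convex_univ, fun a _ b _ s t hs ht _ => ?_⟩
  have : ∑ i, (s • a + t • b) i • x i = s • (∑ i, a i • x i) + t • ∑ i, b i • x i := by
    simp only [Finset.smul_sum, ← Finset.sum_add_distrib]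
    refine Finset.sum_congr rfl fun i _ => ?_
    simp [add_smul, mul_smul]
  simp only [this, smul_eq_mul]
  refine (norm_add_le _ _).trans ?_
  rw [norm_smul, norm_smul, Real.norm_of_nonneg hs, Real.norm_of_nonneg ht]

/-- The cube is the convex hull of its vertices, and a convex function on a hull is dominated by its
value at some generating point. -/
theorem exists_sign_ge_of_convexOn {F : (ι → ℝ) → ℝ} (hF : ConvexOn ℝ univ F) {a : ι → ℝ}
    (ha : ∀ i, |a i| ≤ 1) : ∃ τ : ι → ℤˣ, F a ≤ F fun i => ((τ i : ℤ) : ℝ) := by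
  have hmem : a ∈ convexHull ℝ (univ.pi fun _ : ι => ({-1, 1} : Set ℝ)) := by
    rw [convexHull_pi]
    intro i _
    rw [convexHull_pair, segment_eq_Icc (by norm_num)]
    exact abs_le.mp (ha i)
  obtain ⟨y, hy, hle⟩ := (hF.subset (subset_univ _) (convex_convexHull ℝ _)).exists_ge_of_mem_convexHull
    (subset_convexHull ℝ _) hmem
  refine ⟨fun i => if y i = 1 then 1 else -1, hle.trans_eq ?_⟩
  congr 1
  funext i
  rcases hy i (mem_univ i) with h | h
  · beta_reduce
    rw [h, if_neg (by norm_num)]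
    simp
  · beta_reduce
    rw [mem_singleton_iff.mp h, if_pos rfl]
    simp

variable [DecidableEq ι] [DecidableEq κ]

theorem abs_cast_sign (s : ℤˣ) : |((s : ℤ) : ℝ)| = 1 := by
  rcases Int.units_eq_one_or s with rfl | rfl <;> simp

theorem cast_sign_mul_self (s : ℤˣ) : ((s : ℤ) : ℝ) * ((s : ℤ) : ℝ) = 1 := by
  rcases Int.units_eq_one_or s with rfl | rfl <;> simp

theorem expect_sign_mul_right (G : (ι → ℤˣ) → ℝ) (τ : ι → ℤˣ) :
    𝔼 σ, G (σ * τ) = 𝔼 σ, G σ :=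
  Fintype.expect_equiv (Equiv.mulRight τ) _ _ fun _ => rfl

/-- Translation invariance allows an extra average over `τ`; after exchanging the averages, the
inner one no longer depends on `σ`. -/
theorem expect_sign_comp {e : κ → ι} (he : Function.Injective e) (G : (κ → ℤˣ) → ℝ) :
    𝔼 σ : ι → ℤˣ, G (σ ∘ e) = 𝔼 τ, G τ := by
  have h1 : ∀ τ : κ → ℤˣ, 𝔼 σ : ι → ℤˣ, G (σ ∘ e) = 𝔼 σ : ι → ℤˣ, G ((σ ∘ e) * τ) := by
    intro τ
    rw [← expect_sign_mul_right (fun σ : ι → ℤˣ => G (σ ∘ e)) (Function.extend e τ 1)]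
    refine Finset.expect_congr rfl fun σ _ => ?_
    congr 1
    funext i
    simp [he.extend_apply]
  calc 𝔼 σ : ι → ℤˣ, G (σ ∘ e)
      = 𝔼 _τ : κ → ℤˣ, 𝔼 σ : ι → ℤˣ, G (σ ∘ e) := by rw [Fintype.expect_const]
    _ = 𝔼 τ : κ → ℤˣ, 𝔼 σ : ι → ℤˣ, G ((σ ∘ e) * τ) :=
        Finset.expect_congr rfl fun τ _ => h1 τ
    _ = 𝔼 σ : ι → ℤˣ, 𝔼 τ : κ → ℤˣ, G ((σ ∘ e) * τ) := Finset.expect_comm _ _ _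
    _ = 𝔼 _σ : ι → ℤˣ, 𝔼 τ : κ → ℤˣ, G τ :=
        Finset.expect_congr rfl fun σ _ =>
          Fintype.expect_equiv (Equiv.mulLeft (σ ∘ e)) _ _ fun _ => rfl
    _ = 𝔼 τ, G τ := by rw [Fintype.expect_const]

theorem signAverage_smul (c : ℝ) (x : ι → X) :
    signAverage (fun i => c • x i) = |c| * signAverage x := by
  simp only [signAverage, signSum_smul, norm_smul, Real.norm_eq_abs, Finset.mul_expect]

theorem signAverage_nonneg (x : ι → X) : 0 ≤ signAverage x :=
  Finset.expect_nonneg fun _ _ => norm_nonneg _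

theorem signAverage_sign_smul (τ : ι → ℤˣ) (x : ι → X) :
    signAverage (fun i => ((τ i : ℤ) : ℝ) • x i) = signAverage x := by
  unfold signAverage
  rw [← expect_sign_mul_right _ τ]
  refine Finset.expect_congr rfl fun σ _ => ?_
  simp [signSum, smul_smul, mul_assoc, cast_sign_mul_self]

/-- Contraction principle: the average is convex in the coefficients and takes the same value at all
sign vectors. -/
theorem signAverage_smul_le (x : ι → X) {a : ι → ℝ} (ha : ∀ i, |a i| ≤ 1) :
    signAverage (fun i => a i • x i) ≤ signAverage x := by
  have hconv : ConvexOn ℝ univ fun a : ι → ℝ => signAverage fun i => a i • x i := by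
    have h := fun σ : ι → ℤˣ => convexOn_norm_sum_smul fun i => ((σ i : ℤ) : ℝ) • x i
    refine ⟨convex_univ, fun a ha b hb s t hs ht hst => ?_⟩
    simp only [signAverage, smul_eq_mul, Finset.mul_expect, ← Finset.expect_add_distrib]
    refine Finset.expect_le_expect fun σ _ => ?_
    have := (h σ).2 ha hb hs ht hst
    simpa only [signSum, smul_comm _ ((_ : ℤ) : ℝ) (_ : X), smul_eq_mul] using this
  obtain ⟨τ, hτ⟩ := exists_sign_ge_of_convexOn hconv ha
  exact hτ.trans_eq (signAverage_sign_smul τ x)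

theorem signAverage_comp_le {e : κ → ι} (he : Function.Injective e) (x : ι → X) :
    signAverage (x ∘ e) ≤ signAverage x := by
  classical
  refine le_trans (le_of_eq ?_) (signAverage_smul_le x
    (a := fun i => if i ∈ Set.range e then 1 else 0) fun i => by split_ifs <;> simp)
  unfold signAverage
  rw [← expect_sign_comp he]
  refine Finset.expect_congr rfl fun σ _ => ?_
  congr 1
  simp only [signSum, ite_smul, one_smul, zero_smul, smul_ite, smul_zero, Function.comp]
  rw [← Finset.sum_filter, ← Finset.sum_image (s := Finset.univ) (g := e)
    (f := fun i => ((σ i : ℤ) : ℝ) • x i) (fun a _ b _ h => he h)]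
  refine Finset.sum_congr ?_ fun _ _ => rfl
  ext i
  simp

theorem signAverage_comp_equiv (e : κ ≃ ι) (x : ι → X) :
    signAverage (x ∘ e) = signAverage x := by
  refine le_antisymm (signAverage_comp_le e.injective x) ?_
  have := signAverage_comp_le e.symm.injective (x ∘ e)
  rwa [Function.comp_assoc, e.self_comp_symm, Function.comp_id] at this

theorem norm_le_signAverage (x : ι → X) (i : ι) : ‖x i‖ ≤ signAverage x := by
  refine le_trans (le_of_eq ?_) (signAverage_comp_le (e := fun _ : Unit => i)
    (Function.injective_of_subsingleton _) x)
  have : ∀ σ : Unit → ℤˣ, ‖signSum (x ∘ fun _ : Unit => i) σ‖ = ‖x i‖ := fun σ => by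
    simp [signSum, norm_smul, Real.norm_eq_abs, abs_cast_sign]
  simp only [signAverage, this, Fintype.expect_const]

theorem expect_sign_fin_succ {n : ℕ} (G : (Fin (n + 1) → ℤˣ) → ℝ) :
    𝔼 σ, G σ = 𝔼 σ : Fin n → ℤˣ, (G (Fin.cons 1 σ) + G (Fin.cons (-1) σ)) / 2 := by
  rw [Fintype.expect_eq_sum_div_card, Fintype.expect_eq_sum_div_card,
    ← (Fin.consEquiv fun _ : Fin (n + 1) => ℤˣ).sum_comp, Fintype.sum_prod_type_right]
  have huniv : (Finset.univ : Finset ℤˣ) = {1, -1} := rfl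
  have hcard : Fintype.card ℤˣ = 2 := rfl
  simp only [Fintype.card_pi, Finset.prod_const, ← Finset.sum_div, Finset.card_univ,
    Fintype.card_fin, hcard]
  simp only [huniv, Finset.sum_pair (show (1 : ℤˣ) ≠ -1 by decide), Fin.consEquiv]
  push_cast
  rw [pow_succ, div_div, mul_comm]
  rfl

theorem signSum_fin_cons {n : ℕ} (x : Fin (n + 1) → X) (s : ℤˣ) (σ : Fin n → ℤˣ) :
    signSum x (Fin.cons s σ) = ((s : ℤ) : ℝ) • x 0 + signSum (fun i => x i.succ) σ := by
  simp [signSum, Fin.sum_univ_succ]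

end SignAverage

/-! ### Rademacher averages as sign averages. -/

section Rademacher

theorem rademacher_succ (k : ℕ) (t : ℝ) : rademacher (k + 1) t = rademacher k (2 * t) := by
  unfold rademacher
  congr 2
  ring

theorem rademacher_periodic (k : ℕ) : Function.Periodic (rademacher k) 1 := by
  intro t
  unfold rademacher
  have : (2 : ℝ) ^ (k + 1) * Real.pi * (t + 1)
      = 2 ^ (k + 1) * Real.pi * t + ((2 ^ k : ℕ) : ℝ) * (2 * Real.pi) := by
    push_cast; ring
  rw [this, Real.sin_add_nat_mul_two_pi]

theorem rademacher_zero_of_lt_half {t : ℝ} (h0 : 0 < t) (h1 : t < 1 / 2) : rademacher 0 t = 1 :=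
  Real.sign_of_pos <| Real.sin_pos_of_pos_of_lt_pi (by positivity) (by
    have := Real.pi_pos
    rw [zero_add, pow_one]
    nlinarith)

theorem rademacher_zero_of_half_lt {t : ℝ} (h0 : 1 / 2 < t) (h1 : t < 1) : rademacher 0 t = -1 := by
  refine Real.sign_of_neg ?_
  have hpi := Real.pi_pos
  have : (2 : ℝ) ^ (0 + 1) * Real.pi * t = 2 * Real.pi * t - Real.pi + Real.pi := by ring
  rw [this, Real.sin_add_pi, neg_lt_zero]
  exact Real.sin_pos_of_pos_of_lt_pi (by nlinarith) (by nlinarith)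

theorem measurable_rademacher (k : ℕ) : Measurable (rademacher k) := by
  have hsign : Measurable Real.sign :=
    Measurable.ite measurableSet_Iio measurable_const
      (Measurable.ite measurableSet_Ioi measurable_const measurable_const)
  exact hsign.comp (by fun_prop)

theorem abs_rademacher_le (k : ℕ) (t : ℝ) : |rademacher k t| ≤ 1 := by
  unfold rademacher
  rcases Real.sign_apply_eq (Real.sin (2 ^ (k + 1) * Real.pi * t)) with h | h | h <;> rw [h] <;> simp

variable {X : Type*} [NormedAddCommGroup X] [NormedSpace ℝ X]

theorem intervalIntegrable_norm_add_sum_rademacher {n : ℕ} (y : X) (x : Fin n → X) (a b : ℝ) :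
    IntervalIntegrable (fun t => ‖y + ∑ k : Fin n, rademacher k t • x k‖) MeasureTheory.volume a b := by
  have hcont : Continuous fun c : Fin n → ℝ => ‖y + ∑ k, c k • x k‖ := by fun_prop
  have hmeas : Measurable fun t => ‖y + ∑ k : Fin n, rademacher k t • x k‖ :=
    hcont.measurable.comp (measurable_pi_lambda _ fun k : Fin n => measurable_rademacher k)
  refine (intervalIntegrable_const (c := ‖y‖ + ∑ k, ‖x k‖)).mono_fun
    hmeas.aestronglyMeasurable (Filter.Eventually.of_forall fun t => ?_)
  beta_reduce
  rw [norm_norm]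
  refine le_trans ?_ (le_abs_self _)
  refine (norm_add_le _ _).trans (add_le_add_right ((norm_sum_le _ _).trans
    (Finset.sum_le_sum fun k _ => ?_)) _)
  rw [norm_smul, Real.norm_eq_abs]
  exact mul_le_of_le_one_left (norm_nonneg _) (abs_rademacher_le _ _)

/-- The offset `y` makes the induction work: on each half of the interval the first Rademacher
function is constant and joins `y`, while the others are the Rademacher functions of `2 * t`. -/
theorem integral_norm_add_sum_rademacher {n : ℕ} (y : X) (x : Fin n → X) :
    ∫ t in (0 : ℝ)..1, ‖y + ∑ k : Fin n, rademacher k t • x k‖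
      = 𝔼 σ : Fin n → ℤˣ, ‖y + signSum x σ‖ := by
  induction n generalizing y with
  | zero => simp [signSum]
  | succ n ih =>
    have hper : ∀ z : X, Function.Periodic
        (fun t => ‖z + ∑ k : Fin n, rademacher k t • x k.succ‖) 1 := fun z t => by
      simp only [fun k : Fin n => rademacher_periodic k t]
    have hsplit : ∀ t, ‖y + ∑ k : Fin (n + 1), rademacher k t • x k‖
        = ‖(y + rademacher 0 t • x 0) + ∑ k : Fin n, rademacher k (2 * t) • x k.succ‖ := fun t => by
      rw [Fin.sum_univ_succ, add_assoc]
      simp only [Fin.val_zero, Fin.val_succ, rademacher_succ]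
    have hleft : ∫ t in (0 : ℝ)..(1 / 2), ‖y + ∑ k : Fin (n + 1), rademacher k t • x k‖
        = (1 / 2) * 𝔼 σ : Fin n → ℤˣ, ‖(y + x 0) + signSum (fun i => x i.succ) σ‖ := by
      rw [← ih, intervalIntegral.integral_congr_ae
        (g := fun t => ‖(y + x 0) + ∑ k : Fin n, rademacher k (2 * t) • x k.succ‖),
        intervalIntegral.integral_comp_mul_left
          (fun t => ‖(y + x 0) + ∑ k : Fin n, rademacher k t • x k.succ‖) two_ne_zero]
      · norm_num
      · filter_upwards [MeasureTheory.Measure.ae_ne MeasureTheory.volume (1 / 2 : ℝ)] with t ht hmem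
        rw [uIoc_of_le (by norm_num)] at hmem
        rw [hsplit, rademacher_zero_of_lt_half hmem.1 (lt_of_le_of_ne hmem.2 ht), one_smul]
    have hright : ∫ t in (1 / 2 : ℝ)..1, ‖y + ∑ k : Fin (n + 1), rademacher k t • x k‖
        = (1 / 2) * 𝔼 σ : Fin n → ℤˣ, ‖(y + -x 0) + signSum (fun i => x i.succ) σ‖ := by
      rw [← ih, intervalIntegral.integral_congr_ae
        (g := fun t => ‖(y + -x 0) + ∑ k : Fin n, rademacher k (2 * t) • x k.succ‖),
        intervalIntegral.integral_comp_mul_left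
          (fun t => ‖(y + -x 0) + ∑ k : Fin n, rademacher k t • x k.succ‖) two_ne_zero]
      · have h := (hper (y + -x 0)).intervalIntegral_add_eq 1 0
        rw [zero_add, one_add_one_eq_two] at h
        norm_num at h ⊢
        exact h
      · filter_upwards [MeasureTheory.Measure.ae_ne MeasureTheory.volume (1 : ℝ)] with t ht hmem
        rw [uIoc_of_le (by norm_num)] at hmem
        rw [hsplit, rademacher_zero_of_half_lt hmem.1 (lt_of_le_of_ne hmem.2 ht), neg_one_smul]
    rw [← intervalIntegral.integral_add_adjacent_intervals
      (intervalIntegrable_norm_add_sum_rademacher y x 0 (1 / 2))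
      (intervalIntegrable_norm_add_sum_rademacher y x (1 / 2) 1), hleft, hright, ← mul_add,
      ← Finset.expect_add_distrib, Finset.mul_expect, expect_sign_fin_succ]
    refine Finset.expect_congr rfl fun σ _ => ?_
    rw [signSum_fin_cons, signSum_fin_cons]
    simp only [Units.val_one, Units.val_neg, Int.cast_one, Int.cast_neg, one_smul, neg_smul,
      ← add_assoc]
    ring

theorem rademacherAverage_eq_signAverage {n : ℕ} (x : Fin n → X) :
    rademacherAverage x = signAverage x := by
  simpa [rademacherAverage, signAverage] using integral_norm_add_sum_rademacher 0 x

end Rademacher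

/-! ### Packings in `ℓ¹(Ω; X)` and their multiplicativity. -/

/-- Some `ℓ¹(Ω; X)` with `Ω` finite contains a family indexed by `ι` of vectors of norm at least
`ε` whose sign average is at most `1`. -/
def SignPackable (X : Type*) [NormedAddCommGroup X] [NormedSpace ℝ X] (ε : ℝ) (ι : Type)
    [Fintype ι] [DecidableEq ι] : Prop :=
  ∃ (Ω : Type) (_ : Fintype Ω) (f : ι → Ω → X),
    ∑ ω, signAverage (fun i => f i ω) ≤ 1 ∧ ∀ i, ε ≤ ∑ ω, ‖f i ω‖

namespace SignPackable

variable {X : Type*} [NormedAddCommGroup X] [NormedSpace ℝ X] {ι κ μ : Type} [Fintype ι]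
  [DecidableEq ι] [Fintype κ] [DecidableEq κ] [Fintype μ] [DecidableEq μ] {ε δ s t : ℝ}

theorem of_vectors {x : ι → X} (hx : signAverage x ≤ 1) (hε : ∀ i, ε ≤ ‖x i‖) :
    SignPackable X ε ι :=
  ⟨Unit, inferInstance, fun i _ => x i, by simpa using hx, by simpa using hε⟩

theorem anti (h : ε ≤ δ) : SignPackable X δ ι → SignPackable X ε ι :=
  fun ⟨Ω, _, f, hf, hδ⟩ => ⟨Ω, _, f, hf, fun i => h.trans (hδ i)⟩

theorem of_injective {e : κ → ι} (he : Function.Injective e) :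
    SignPackable X ε ι → SignPackable X ε κ :=
  fun ⟨Ω, _, f, hf, hε⟩ => ⟨Ω, _, f ∘ e,
    (Finset.sum_le_sum fun ω _ => signAverage_comp_le he fun i => f i ω).trans hf, fun i => hε (e i)⟩

theorem of_le {m n : ℕ} (h : m ≤ n) : SignPackable X ε (Fin n) → SignPackable X ε (Fin m) :=
  of_injective (Fin.castLE_injective h)

theorem of_scaled {Ω : Type} [Fintype Ω] (hs : 0 < s) {f : ι → Ω → X}
    (hf : ∑ ω, signAverage (fun i => f i ω) ≤ s) (ht : ∀ i, s * t ≤ ∑ ω, ‖f i ω‖) :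
    SignPackable X t ι := by
  refine ⟨Ω, inferInstance, fun i ω => s⁻¹ • f i ω, ?_, fun i => ?_⟩
  · simp only [signAverage_smul, ← Finset.mul_sum, abs_of_pos (inv_pos.mpr hs)]
    rw [inv_mul_le_iff₀ hs, mul_one]
    exact hf
  · simp only [norm_smul, ← Finset.mul_sum, Real.norm_of_nonneg (inv_pos.mpr hs).le]
    rw [le_inv_mul_iff₀ hs]
    exact ht i

/-- Sum each block `{i} × μ` with random signs, and regard the signs as new points of `Ω`. Signing
the blocks again does not change the distribution, so the sign average is preserved. A block sum of
norm below `s` would, after division by `s`, give a forbidden packing by `μ`. -/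
theorem of_prod (hs : 0 < s) (h : SignPackable X (s * t) (κ × μ)) (hμ : ¬ SignPackable X t μ) :
    SignPackable X s κ := by
  obtain ⟨Ω, _, f, hf, hst⟩ := h
  -- The norm of `ℓ¹` uses counting measure, so the probability `c` of a sign pattern is put into
  -- the vectors.
  set c : ℝ := (Fintype.card (κ × μ → ℤˣ) : ℝ)⁻¹ with hc
  have hc0 : 0 ≤ c := by positivity
  have hexp : ∀ G : (κ × μ → ℤˣ) → ℝ, ∑ σ, c * G σ = 𝔼 σ, G σ := fun G => by
    rw [← Finset.mul_sum, Fintype.expect_eq_sum_div_card, hc, div_eq_inv_mul]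
  refine ⟨Ω × (κ × μ → ℤˣ), inferInstance,
    fun i p => c • signSum (fun j => f (i, j) p.1) (fun j => p.2 (i, j)), ?_, fun i => ?_⟩
  · refine le_trans (le_of_eq ?_) hf
    rw [Fintype.sum_prod_type]
    refine Finset.sum_congr rfl fun ω _ => ?_
    simp only [signAverage_smul, abs_of_nonneg hc0]
    rw [hexp]
    simp only [signAverage]
    rw [Finset.expect_comm]
    have hτ : ∀ τ : κ → ℤˣ, 𝔼 σ : κ × μ → ℤˣ,
        ‖signSum (fun i => signSum (fun j => f (i, j) ω) fun j => σ (i, j)) τ‖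
          = 𝔼 σ : κ × μ → ℤˣ, ‖signSum (fun i => f i ω) σ‖ := fun τ => by
      rw [← expect_sign_mul_right (fun σ => ‖signSum (fun i => f i ω) σ‖) fun p => τ p.1]
      refine Finset.expect_congr rfl fun σ _ => ?_
      congr 1
      simp only [signSum, Fintype.sum_prod_type, Finset.smul_sum, smul_smul, Pi.mul_apply]
      refine Finset.sum_congr rfl fun i _ => Finset.sum_congr rfl fun j _ => ?_
      push_cast
      rw [mul_comm]
    rw [Finset.expect_congr rfl fun τ _ => hτ τ, Fintype.expect_const]
  · by_contra! hlt
    refine hμ (of_scaled hs (f := fun j ω => f (i, j) ω) (le_trans (le_of_eq ?_) hlt.le)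
      fun j => hst (i, j))
    rw [Fintype.sum_prod_type]
    refine Finset.sum_congr rfl fun ω _ => ?_
    simp only [norm_smul, Real.norm_of_nonneg hc0]
    rw [hexp]
    exact (expect_sign_comp (e := fun j : μ => (i, j)) (fun _ _ h => (Prod.mk.inj h).2)
      fun τ => ‖signSum (fun j => f (i, j) ω) τ‖).symm

theorem le_one [Nonempty ι] (h : SignPackable X ε ι) : ε ≤ 1 := by
  obtain ⟨Ω, _, f, hf, hε⟩ := h
  obtain ⟨i⟩ := ‹Nonempty ι›
  exact (hε i).trans ((Finset.sum_le_sum fun ω _ =>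
    norm_le_signAverage (fun i => f i ω) i).trans hf)

/-- Jensen's inequality transfers a convex cotype inequality from `X` to `ℓ¹(Ω; X)`. -/
theorem card_mul_le_one (h : SignPackable X ε ι) (hε : 0 ≤ ε) {φ : ℝ → ℝ}
    (hmono : MonotoneOn φ (Icc 0 1)) (hconv : ConvexOn ℝ (Icc 0 1) φ)
    (hφ : ∀ x : ι → X, signAverage x ≤ 1 → ∑ i, φ ‖x i‖ ≤ 1) : Fintype.card ι * φ ε ≤ 1 := by
  rcases isEmpty_or_nonempty ι with hι | hι
  · simp
  have hε1 := h.le_one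
  obtain ⟨Ω, _, f, hf, hle⟩ := h
  set g : Ω → ℝ := fun ω => signAverage fun i => f i ω with hg
  have hg0 : ∀ ω, 0 ≤ g ω := fun ω => signAverage_nonneg _
  have hfg : ∀ i ω, ‖f i ω‖ ≤ g ω := fun i ω => norm_le_signAverage (fun i => f i ω) i
  have hnorm : ∀ i ω, ‖(g ω)⁻¹ • f i ω‖ = (g ω)⁻¹ * ‖f i ω‖ := fun i ω => by
    rw [norm_smul, Real.norm_of_nonneg (inv_nonneg.mpr (hg0 ω))]
  have hcancel : ∀ i ω, g ω * ‖(g ω)⁻¹ • f i ω‖ = ‖f i ω‖ := fun i ω => by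
    rcases (hg0 ω).eq_or_lt with h0 | h0
    · have := hfg i ω
      rw [← h0] at this ⊢
      rw [zero_mul, le_antisymm this (norm_nonneg _)]
    · rw [hnorm, mul_inv_cancel_left₀ h0.ne']
  have hball : ∀ i ω, ‖(g ω)⁻¹ • f i ω‖ ∈ Icc (0 : ℝ) 1 := fun i ω =>
    ⟨norm_nonneg _, by rw [hnorm]; exact inv_mul_le_one_of_le₀ (hfg i ω) (hg0 ω)⟩
  have hscaled : ∀ ω, ∑ i, φ ‖(g ω)⁻¹ • f i ω‖ ≤ 1 := fun ω => hφ _ <| by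
    rw [signAverage_smul, abs_of_nonneg (inv_nonneg.mpr (hg0 ω))]
    exact inv_mul_le_one_of_le₀ le_rfl (hg0 ω)
  have hzero : ∑ _i : ι, φ 0 ≤ 1 := by
    simpa using hφ (fun _ => 0) (by simp [signAverage, signSum])
  have hsum : ∀ i, φ ε ≤ (1 - ∑ ω, g ω) * φ 0 + ∑ ω, g ω * φ ‖(g ω)⁻¹ • f i ω‖ := fun i => by
    -- The weights `g ω` may sum to less than `1`; the remaining mass is placed at `0`.
    have hJ := hconv.map_add_sum_le (t := Finset.univ) (w := g)
      (p := fun ω => ‖(g ω)⁻¹ • f i ω‖) (v := 1 - ∑ ω, g ω) (q := 0)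
      (fun ω _ => hg0 ω) (by ring) (fun ω _ => hball i ω) (by linarith) (by simp)
    simp only [smul_eq_mul, mul_zero, zero_add, hcancel] at hJ
    refine (hmono ⟨hε, hε1⟩ ⟨hε.trans (hle i), ?_⟩ (hle i)).trans hJ
    exact (Finset.sum_le_sum fun ω _ => hfg i ω).trans hf
  calc Fintype.card ι * φ ε = ∑ _i : ι, φ ε := by simp
    _ ≤ ∑ i, ((1 - ∑ ω, g ω) * φ 0 + ∑ ω, g ω * φ ‖(g ω)⁻¹ • f i ω‖) :=
        Finset.sum_le_sum fun i _ => hsum i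
    _ = (1 - ∑ ω, g ω) * ∑ _i : ι, φ 0 + ∑ ω, g ω * ∑ i, φ ‖(g ω)⁻¹ • f i ω‖ := by
        rw [Finset.sum_add_distrib, Finset.mul_sum, Finset.sum_comm]
        simp only [Finset.mul_sum]
    _ ≤ (1 - ∑ ω, g ω) * 1 + ∑ ω, g ω * 1 :=
        add_le_add (mul_le_mul_of_nonneg_left hzero (by linarith))
          (Finset.sum_le_sum fun ω _ => mul_le_mul_of_nonneg_left (hscaled ω) (hg0 ω))
    _ = 1 := by simp

theorem of_forall_fin_mul (hs : 0 < s) (h : ∀ n, SignPackable X (s * t) (Fin n)) :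
    (∀ n, SignPackable X s (Fin n)) ∨ ∀ n, SignPackable X t (Fin n) := by
  by_contra! hcon
  obtain ⟨⟨k, hk⟩, m, hm⟩ := hcon
  exact hk (of_prod hs ((h (k * m)).of_injective finProdFinEquiv.injective) hm)

/-- The dichotomy with `s = t` passes from `ε` to its square root; repeated square roots approach
`1`. -/
theorem forall_fin_of_lt_one (hε : 0 < ε) (h : ∀ n, SignPackable X ε (Fin n)) (hδ : δ < 1) (n : ℕ) :
    SignPackable X δ (Fin n) := by
  have hroot : ∀ k : ℕ, ∀ η : ℝ, 0 < η → η ^ 2 ^ k = ε → ∀ n, SignPackable X η (Fin n) := by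
    intro k
    induction k with
    | zero => intro η _ he; rw [pow_zero, pow_one] at he; rwa [he]
    | succ k ih =>
      intro η hη he
      have := ih (η * η) (by positivity) (by rw [← he, ← pow_two, ← pow_mul, pow_succ' 2 k])
      simpa using of_forall_fin_mul hη this
  rcases le_or_gt δ 0 with h0 | h0
  · exact (h n).anti (h0.trans hε.le)
  obtain ⟨k, hk⟩ := exists_pow_lt_of_lt_one hε hδ
  have hpow : δ ^ 2 ^ k ≤ ε :=
    (pow_le_pow_of_le_one h0.le hδ.le Nat.lt_two_pow_self.le).trans hk.le
  have hη : (ε ^ ((2 ^ k : ℕ) : ℝ)⁻¹) ^ 2 ^ k = ε :=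
    Real.rpow_inv_natCast_pow hε.le (by positivity)
  refine (hroot k _ (by positivity) hη n).anti ?_
  by_contra! hlt
  exact absurd (pow_lt_pow_left₀ hlt (by positivity) (n := 2 ^ k) (by positivity))
    (by rw [hη]; exact hpow.not_gt)

/-- If every normalized fibre over `Ω` had a vector shorter than `1 - η`, each fibre would lose `η *
g ω` in its sum of norms. The packing, taken at level `1 - η / (n + 1)`, loses less than `η` in
total. -/
theorem exists_vectors (hε : 0 < ε) (h : ∀ n, SignPackable X ε (Fin n)) (n : ℕ) {η : ℝ}
    (hη : 0 < η) : ∃ x : Fin n → X, signAverage x ≤ 1 ∧ ∀ i, 1 - η ≤ ‖x i‖ := by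
  obtain ⟨Ω, _, f, hf, hle⟩ :=
    forall_fin_of_lt_one hε h (sub_lt_self 1 (show 0 < η / (n + 1) by positivity)) n
  set g : Ω → ℝ := fun ω => signAverage fun i => f i ω with hg
  have hg0 : ∀ ω, 0 ≤ g ω := fun ω => signAverage_nonneg _
  have hfg : ∀ i ω, ‖f i ω‖ ≤ g ω := fun i ω => norm_le_signAverage (fun i => f i ω) i
  by_contra! hcon
  have hbad : ∀ ω, ∑ i, ‖f i ω‖ ≤ (n - η) * g ω := by
    intro ω
    obtain ⟨i, hi⟩ : ∃ i, ‖f i ω‖ ≤ (1 - η) * g ω := by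
      obtain ⟨i, hi⟩ := hcon (fun i => (g ω)⁻¹ • f i ω) (by
        rw [signAverage_smul, abs_of_nonneg (inv_nonneg.mpr (hg0 ω))]
        exact inv_mul_le_one_of_le₀ le_rfl (hg0 ω))
      refine ⟨i, ?_⟩
      rcases (hg0 ω).eq_or_lt with h0 | h0
      · have := hfg i ω
        rw [← h0] at this ⊢
        simpa using this
      · rw [norm_smul, Real.norm_of_nonneg (inv_nonneg.mpr h0.le), inv_mul_lt_iff₀ h0] at hi
        linarith
    rw [← Finset.add_sum_erase _ _ (Finset.mem_univ i)]
    have : ∑ j ∈ Finset.univ.erase i, ‖f j ω‖ ≤ (n - 1) * g ω := by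
      refine (Finset.sum_le_sum fun j _ => hfg j ω).trans_eq ?_
      rw [Finset.sum_const, Finset.card_erase_of_mem (Finset.mem_univ i), Finset.card_fin,
        nsmul_eq_mul, Nat.cast_pred (i.pos)]
    linarith
  -- The zero family yields `η < 1` and `0 < n`, so that `n - η` is positive in the final estimate.
  obtain ⟨i, hi⟩ := hcon 0 (by simp [signAverage, signSum])
  rw [Pi.zero_apply, norm_zero] at hi
  have hn : 0 < n := i.pos
  have h1 : (n : ℝ) * (1 - η / (n + 1)) ≤ ∑ i, ∑ ω, ‖f i ω‖ := by
    refine le_trans (le_of_eq ?_) (Finset.sum_le_sum fun i _ => hle i)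
    rw [Finset.sum_const, Finset.card_fin, nsmul_eq_mul]
  have h2 : ∑ i, ∑ ω, ‖f i ω‖ ≤ (n - η) * ∑ ω, g ω := by
    rw [Finset.sum_comm, Finset.mul_sum]
    exact Finset.sum_le_sum fun ω _ => hbad ω
  have hn1 : (1 : ℝ) ≤ n := by exact_mod_cast hn
  have h3 : n * (1 - η / (n + 1)) = n - η + η / (n + 1) := by
    field_simp
    ring
  have h4 : 0 < η / (n + 1) := by positivity
  nlinarith

end SignPackable

/-! ### Infinite packing numbers make `c₀` finitely representable. -/

section CZero

open scoped ZeroAtInfty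

variable {X : Type*} [NormedAddCommGroup X] [NormedSpace ℝ X]

/-- Vectors whose sign average is nearly as small as each single norm span, after one of them is
dropped, a subspace whose norm nearly dominates and is nearly dominated by the sup norm. -/
theorem norm_sum_smul_bounds {n : ℕ} {η : ℝ} (x : Fin (n + 1) → X) (hx : signAverage x ≤ 1)
    (hle : ∀ i, 1 - η ≤ ‖x i‖) {a : Fin n → ℝ} (ha : ∀ i, |a i| ≤ 1) :
    ‖∑ i, a i • x i.succ‖ ≤ 1 + 2 ^ n * η ∧
      ∀ i, |a i| = 1 → 1 - (2 ^ n + 2) * η ≤ ‖∑ i, a i • x i.succ‖ := by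
  set k : (Fin n → ℤˣ) → ℝ := fun σ =>
    (‖signSum x (Fin.cons 1 σ)‖ + ‖signSum x (Fin.cons (-1) σ)‖) / 2 with hk
  have hcons : ∀ σ : Fin n → ℤˣ, signSum x (Fin.cons 1 σ) = x 0 + signSum (fun i => x i.succ) σ ∧
      signSum x (Fin.cons (-1) σ) = -x 0 + signSum (fun i => x i.succ) σ := fun σ => by
    rw [signSum_fin_cons, signSum_fin_cons]
    simp
  -- The `2 ^ n` numbers `k σ` have mean at most `1` and are all at least `1 - η`, so none exceeds
  -- `1` by more than `(2 ^ n - 1) * η`.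
  have hk_ge : ∀ σ, 1 - η ≤ k σ := fun σ => by
    have h := norm_sub_le (signSum x (Fin.cons 1 σ)) (signSum x (Fin.cons (-1) σ))
    have h2 : signSum x (Fin.cons 1 σ) - signSum x (Fin.cons (-1) σ) = (2 : ℝ) • x 0 := by
      rw [(hcons σ).1, (hcons σ).2, two_smul]; abel
    rw [h2, norm_smul, Real.norm_two] at h
    have := hle 0
    simp only [hk]
    linarith
  have hsum : ∑ σ, k σ ≤ 2 ^ n := by
    unfold signAverage at hx
    rw [expect_sign_fin_succ, Fintype.expect_eq_sum_div_card, div_le_one (by positivity)] at hx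
    simpa using hx
  have hη : 0 ≤ η := by
    have := (hle 0).trans ((norm_le_signAverage x 0).trans hx)
    linarith
  have hk_le : ∀ σ, k σ ≤ 1 + 2 ^ n * η := fun σ => by
    rw [← Finset.add_sum_erase _ _ (Finset.mem_univ σ)] at hsum
    have h := Finset.card_nsmul_le_sum (Finset.univ.erase σ) k (1 - η) fun τ _ => hk_ge τ
    have hcard : ((Finset.univ.erase σ).card : ℝ) = 2 ^ n - 1 := by
      rw [Finset.card_erase_of_mem (Finset.mem_univ σ), Nat.cast_pred (Finset.card_pos.mpr ⟨σ, Finset.mem_univ σ⟩)]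
      simp
    rw [nsmul_eq_mul, hcard] at h
    linarith
  have hsigns : ∀ σ : Fin n → ℤˣ, ‖signSum (fun i => x i.succ) σ‖ ≤ 1 + 2 ^ n * η := fun σ => by
    refine le_trans ?_ (hk_le σ)
    have h := norm_add_le (signSum x (Fin.cons 1 σ)) (signSum x (Fin.cons (-1) σ))
    have h2 : signSum x (Fin.cons 1 σ) + signSum x (Fin.cons (-1) σ)
        = (2 : ℝ) • signSum (fun i => x i.succ) σ := by
      rw [(hcons σ).1, (hcons σ).2, two_smul]; abel
    rw [h2, norm_smul, Real.norm_two] at h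
    simp only [hk]
    linarith
  have hupper : ∀ b : Fin n → ℝ, (∀ i, |b i| ≤ 1) → ‖∑ i, b i • x i.succ‖ ≤ 1 + 2 ^ n * η :=
    fun b hb => by
      obtain ⟨τ, hτ⟩ := exists_sign_ge_of_convexOn
        (convexOn_norm_sum_smul fun i : Fin n => x i.succ) hb
      exact hτ.trans (hsigns τ)
  refine ⟨hupper a ha, fun i hi => ?_⟩
  -- Reversing all coefficients except the `i`-th and adding leaves `2 * a i` times one vector; the
  -- upper bound for the reversed sum then gives the lower bound.
  have hflip := hupper (fun j => if j = i then a i else -a j) fun j => by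
    split_ifs
    · exact ha i
    · rw [abs_neg]; exact ha j
  have hadd : (2 * a i) • x i.succ = ∑ j, a j • x j.succ
      + ∑ j, (if j = i then a i else -a j) • x j.succ := by
    rw [← Finset.sum_add_distrib, Finset.sum_eq_single i]
    · rw [if_pos rfl, ← add_smul, two_mul]
    · intro j _ hj
      rw [if_neg hj, neg_smul, add_neg_cancel]
    · simp
  have h := norm_add_le (∑ j, a j • x j.succ) (∑ j, (if j = i then a i else -a j) • x j.succ)
  rw [← hadd, norm_smul, Real.norm_eq_abs, abs_mul, hi, abs_two] at h
  have := hle i.succ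
  linarith

/-- If the sign packing numbers of `X` are infinite then `X` contains the spaces `ℓ^∞_n`
uniformly. -/
theorem exists_supNorm_embedding {ε : ℝ} (hε : 0 < ε) (h : ∀ n, SignPackable X ε (Fin n)) (n : ℕ)
    {δ : ℝ} (hδ : 0 < δ) : ∃ x : Fin n → X, ∀ (a : Fin n → ℝ) (M : ℝ), 0 ≤ M →
      (∀ i, |a i| ≤ M) → ‖∑ i, a i • x i‖ ≤ (1 + δ) * M ∧
        ((∃ i, |a i| = M) → (1 - δ) * M ≤ ‖∑ i, a i • x i‖) := by
  obtain ⟨x, hx, hle⟩ := SignPackable.exists_vectors hε h (n + 1)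
    (show 0 < δ / (2 ^ n + 2) by positivity)
  refine ⟨fun i => x i.succ, fun a M hM ha => ?_⟩
  rcases hM.eq_or_lt with rfl | hM
  · have : a = 0 := funext fun i => abs_nonpos_iff.mp (ha i)
    simp [this]
  have h2 : (2 ^ n + 2) * (δ / (2 ^ n + 2)) = δ := by field_simp
  have h3 : 2 ^ n * (δ / (2 ^ n + 2)) ≤ δ := by
    have : 0 < δ / (2 ^ n + 2) := by positivity
    linarith
  have hb := norm_sum_smul_bounds x hx hle (a := fun i => M⁻¹ * a i) fun i => by
    rw [abs_mul, abs_of_pos (inv_pos.mpr hM)]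
    exact inv_mul_le_one_of_le₀ (ha i) hM.le
  have hnorm : ‖∑ i, (M⁻¹ * a i) • x i.succ‖ = M⁻¹ * ‖∑ i, a i • x i.succ‖ := by
    simp only [mul_smul, ← Finset.smul_sum]
    rw [norm_smul, Real.norm_of_nonneg (inv_pos.mpr hM).le]
  rw [hnorm, h2] at hb
  refine ⟨?_, fun ⟨i, hi⟩ => ?_⟩
  · have := hb.1.trans (add_le_add_right h3 1)
    rw [inv_mul_le_iff₀ hM] at this
    linarith
  · have := hb.2 i (by rw [abs_mul, abs_of_pos (inv_pos.mpr hM), hi, inv_mul_cancel₀ hM.ne'])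
    rw [le_inv_mul_iff₀ hM] at this
    linarith

theorem ZeroAtInftyContinuousMap.abs_apply_le {α : Type*} [TopologicalSpace α] (f : C₀(α, ℝ))
    (i : α) : |f i| ≤ ‖f‖ :=
  f.toBCF.norm_coe_le_norm i

theorem ZeroAtInftyContinuousMap.norm_le_of_forall {α : Type*} [TopologicalSpace α] {f : C₀(α, ℝ)}
    {C : ℝ} (hC : 0 ≤ C) (h : ∀ i, |f i| ≤ C) : ‖f‖ ≤ C :=
  (BoundedContinuousFunction.norm_le (f := f.toBCF) hC).mpr h

/-- Finitely many functionals of a norming family almost determine the norm of a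
finite-dimensional space. -/
theorem exists_finset_norming {α E : Type*} [NormedAddCommGroup E] [NormedSpace ℝ E]
    [FiniteDimensional ℝ E] (L : α → StrongDual ℝ E)
    (hL : ∀ (e : E) (C : ℝ), 0 ≤ C → (∀ i, |L i e| ≤ C) → ‖e‖ ≤ C) {δ : ℝ} (hδ : 0 < δ) :
    ∃ F : Finset α, ∀ e : E, e ≠ 0 → ∃ i ∈ F, (1 - δ) * ‖e‖ < |L i e| := by
  -- The open sets where one functional exceeds `1 - δ` cover the compact unit sphere.
  have := FiniteDimensional.proper ℝ E
  obtain ⟨F, hF⟩ := (isCompact_sphere (0 : E) 1).elim_finite_subcover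
    (fun i : α => {e : E | 1 - δ < |L i e|})
    (fun i => isOpen_lt continuous_const (L i).continuous.abs) fun e he => by
      rw [mem_sphere_zero_iff_norm] at he
      rw [mem_iUnion]
      by_contra! hcon
      have h := hL e (max (1 - δ) 0) (le_max_right _ _) fun i =>
        (not_lt.mp (hcon i)).trans (le_max_left _ _)
      rw [he] at h
      rcases le_max_iff.mp h with h | h <;> linarith
  refine ⟨F, fun e he => ?_⟩
  have hpos : 0 < ‖e‖ := norm_pos_iff.mpr he
  have hmem := @hF (‖e‖⁻¹ • e) <| by
    rw [mem_sphere_zero_iff_norm, norm_smul, norm_inv, norm_norm, inv_mul_cancel₀ hpos.ne']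
  simp only [mem_iUnion, mem_ofPred_eq] at hmem
  obtain ⟨i, hi, hlt⟩ := hmem
  refine ⟨i, hi, ?_⟩
  rw [map_smul, smul_eq_mul, abs_mul, abs_of_pos (inv_pos.mpr hpos), lt_inv_mul_iff₀ hpos] at hlt
  linarith

/-- The evaluation functionals on `c₀(α)`. -/
noncomputable def ZeroAtInftyContinuousMap.coord {α : Type*} [TopologicalSpace α] (i : α) :
    StrongDual ℝ C₀(α, ℝ) :=
  LinearMap.mkContinuous
    { toFun := fun f => f i, map_add' := fun _ _ => rfl, map_smul' := fun _ _ => rfl } 1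
    fun f => by rw [one_mul]; exact f.abs_apply_le i

theorem ZeroAtInftyContinuousMap.coord_apply {α : Type*} [TopologicalSpace α] (i : α)
    (f : C₀(α, ℝ)) : coord i f = f i := rfl

/-- Finitely many coordinates almost norm `E`, which places it in some `ℓ^∞_n` and hence in `X`.
Both maps lose a factor `1 - δ`, whence the normalization of `T`. -/
theorem finitelyRepresentable_zeroAtInfty {α : Type*} [TopologicalSpace α] {ε : ℝ} (hε : 0 < ε)
    (h : ∀ n, SignPackable X ε (Fin n)) : FinitelyRepresentable C₀(α, ℝ) X := by
  intro E hE θ hθ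
  obtain ⟨δ, hδ, hδ1, hδθ⟩ : ∃ δ : ℝ, 0 < δ ∧ δ < 1 ∧ (1 + δ) ≤ (1 + θ) * ((1 - δ) * (1 - δ)) := by
    refine ⟨min (1 / 2) (θ / (3 + 2 * θ)), by positivity, by
      exact (min_le_left _ _).trans_lt (by norm_num), ?_⟩
    have h1 : min (1 / 2) (θ / (3 + 2 * θ)) * (3 + 2 * θ) ≤ θ :=
      (le_div_iff₀ (by positivity)).mp (min_le_right _ _)
    have h0 : 0 ≤ min (1 / 2) (θ / (3 + 2 * θ)) := by positivity
    nlinarith [sq_nonneg (min (1 / 2) (θ / (3 + 2 * θ))), mul_nonneg hθ.le (sq_nonneg (min (1 / 2) (θ / (3 + 2 * θ))))]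
  obtain ⟨F, hF⟩ := exists_finset_norming
    (fun i => (ZeroAtInftyContinuousMap.coord (α := α) i).comp E.subtypeL)
    (fun e C hC h => ZeroAtInftyContinuousMap.norm_le_of_forall (f := (e : C₀(α, ℝ))) hC h) hδ
  obtain ⟨x, hx⟩ := exists_supNorm_embedding hε h F.card hδ
  have hδ2 : 0 < (1 - δ) * (1 - δ) := by nlinarith
  let idx := F.equivFin
  let T : E →ₗ[ℝ] X :=
    { toFun := fun e => ((1 - δ) * (1 - δ))⁻¹ •
        ∑ i : Fin F.card, (e : C₀(α, ℝ)) (idx.symm i) • x i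
      map_add' := fun e e' => by
        simp [add_smul, Finset.sum_add_distrib]
      map_smul' := fun c e => by
        simp only [Submodule.coe_smul, ZeroAtInftyContinuousMap.smul_apply, smul_eq_mul, mul_smul,
          RingHom.id_apply]
        rw [← Finset.smul_sum, smul_comm] }
  have hTnorm : ∀ e : E, ‖T e‖ = ((1 - δ) * (1 - δ))⁻¹ *
      ‖∑ i : Fin F.card, (e : C₀(α, ℝ)) (idx.symm i) • x i‖ := fun e => by
    rw [← Real.norm_of_nonneg (inv_pos.mpr hδ2).le, ← norm_smul]
    rfl
  refine ⟨T, fun e => ?_⟩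
  rcases eq_or_ne e 0 with rfl | he
  · simp
  have hup := (hx (fun i => (e : C₀(α, ℝ)) (idx.symm i)) ‖e‖ (norm_nonneg _)
    fun i => (e : C₀(α, ℝ)).abs_apply_le _).1
  obtain ⟨i₀, hi₀, hlt⟩ := hF e he
  have hne : (Finset.univ : Finset (Fin F.card)).Nonempty := ⟨idx ⟨i₀, hi₀⟩, Finset.mem_univ _⟩
  obtain ⟨i, -, hmax⟩ := Finset.exists_max_image Finset.univ
    (fun i => |(e : C₀(α, ℝ)) (idx.symm i)|) hne
  have hlow := (hx (fun i => (e : C₀(α, ℝ)) (idx.symm i)) |(e : C₀(α, ℝ)) (idx.symm i)|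
    (abs_nonneg _) fun j => hmax j (Finset.mem_univ j)).2 ⟨i, rfl⟩
  have hbig := hmax (idx ⟨i₀, hi₀⟩) (Finset.mem_univ _)
  rw [Equiv.symm_apply_apply] at hbig
  rw [hTnorm, le_inv_mul_iff₀ hδ2, inv_mul_le_iff₀ hδ2]
  constructor
  · refine le_trans ?_ hlow
    rw [mul_assoc]
    exact mul_le_mul_of_nonneg_left (hlt.le.trans hbig) (by linarith)
  · refine hup.trans ?_
    calc (1 + δ) * ‖e‖ ≤ ((1 + θ) * ((1 - δ) * (1 - δ))) * ‖e‖ :=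
          mul_le_mul_of_nonneg_right hδθ (norm_nonneg _)
      _ = _ := by ring

/-! ### Non-reflexivity of `c₀` and finiteness of the packing numbers. -/

/-- A weakly unconditionally summable family has a sum in the bidual. -/
theorem exists_bidual_apply_eq_tsum {ι E : Type*} [NormedAddCommGroup E] [NormedSpace ℝ E]
    (u : ι → E) (hu : ∀ (f : StrongDual ℝ E) (s : Finset ι), ∑ i ∈ s, |f (u i)| ≤ ‖f‖) :
    ∃ Φ : StrongDual ℝ (StrongDual ℝ E), ∀ f, Φ f = ∑' i, f (u i) := by
  have hsummable : ∀ f : StrongDual ℝ E, Summable fun i => |f (u i)| :=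
    fun f => summable_of_sum_le (fun _ => abs_nonneg _) (hu f)
  let Φ : StrongDual ℝ E →ₗ[ℝ] ℝ :=
    { toFun := fun f => ∑' i, f (u i)
      map_add' := fun f g => by
        simp only [add_apply]
        exact (hsummable f).of_abs.tsum_add (hsummable g).of_abs
      map_smul' := fun c f => by
        simp only [smul_apply, RingHom.id_apply]
        exact tsum_mul_left }
  have hΦ : ∀ f, ‖Φ f‖ ≤ 1 * ‖f‖ := fun f => by
    have h1 : |∑' i, f (u i)| ≤ ∑' i, |f (u i)| := by
      simpa only [Real.norm_eq_abs] using norm_tsum_le_tsum_norm (f := fun i => f (u i))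
        (by simpa only [Real.norm_eq_abs] using hsummable f)
    rw [one_mul, Real.norm_eq_abs]
    exact h1.trans ((hsummable f).tsum_le_of_sum_le (hu f))
  exact ⟨Φ.mkContinuous 1 hΦ, fun f => Φ.mkContinuous_apply 1 hΦ f⟩

variable {α : Type*} [TopologicalSpace α] [DiscreteTopology α]

open Classical in
/-- The element of `c₀(α)` which agrees with `c` on the finite set `s` and vanishes elsewhere. -/
noncomputable def ZeroAtInftyContinuousMap.ofFinset (s : Finset α) (c : α → ℝ) : C₀(α, ℝ) where
  toFun j := if j ∈ s then c j else 0
  continuous_toFun := continuous_of_discreteTopology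
  zero_at_infty' := by
    refine tendsto_const_nhds.congr' ?_
    rw [Filter.cocompact_eq_cofinite]
    filter_upwards [s.finite_toSet.compl_mem_cofinite] with j hj
    rw [if_neg (by simpa using hj)]

open Classical in
theorem ZeroAtInftyContinuousMap.ofFinset_apply (s : Finset α) (c : α → ℝ) (j : α) :
    ofFinset s c j = if j ∈ s then c j else 0 := rfl

/-- The unit vectors of `c₀(α)`. -/
noncomputable def ZeroAtInftyContinuousMap.unitVector (i : α) : C₀(α, ℝ) := ofFinset {i} 1

open Classical in
theorem ZeroAtInftyContinuousMap.unitVector_apply (i j : α) :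
    unitVector i j = if j = i then 1 else 0 := by
  simp [unitVector, ofFinset_apply]

theorem ZeroAtInftyContinuousMap.ofFinset_eq_sum (s : Finset α) (c : α → ℝ) :
    ofFinset s c = ∑ i ∈ s, c i • unitVector i := by
  classical
  induction s using Finset.induction_on with
  | empty => ext j; simp [ofFinset_apply]
  | insert i s hi ih =>
    rw [Finset.sum_insert hi, ← ih]
    ext j
    rw [add_apply, smul_apply, unitVector_apply, ofFinset_apply, ofFinset_apply]
    by_cases hj : j = i
    · subst hj; simp [hi]
    · simp [hj]

theorem ZeroAtInftyContinuousMap.sum_abs_le (f : StrongDual ℝ C₀(α, ℝ)) (s : Finset α) :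
    ∑ i ∈ s, |f (unitVector i)| ≤ ‖f‖ := by
  have h1 : ∑ i ∈ s, |f (unitVector i)|
      = f (ofFinset s fun i => SignType.sign (f (unitVector i))) := by
    rw [ofFinset_eq_sum, map_sum]
    refine Finset.sum_congr rfl fun i _ => ?_
    rw [map_smul, smul_eq_mul, sign_mul_self]
  rw [h1]
  refine (le_abs_self _).trans ((f.le_opNorm _).trans ?_)
  refine mul_le_of_le_one_right (norm_nonneg _) (norm_le_of_forall zero_le_one fun j => ?_)
  rw [ofFinset_apply]
  split_ifs
  · cases SignType.sign (f (unitVector j)) <;> simp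
  · simp

/-- `c₀` is not reflexive. -/
theorem not_isReflexiveSpace_zeroAtInfty [Infinite α] : ¬ IsReflexiveSpace C₀(α, ℝ) := by
  classical
  intro hrefl
  obtain ⟨Φ, hΦ⟩ := exists_bidual_apply_eq_tsum (ZeroAtInftyContinuousMap.unitVector (α := α))
    ZeroAtInftyContinuousMap.sum_abs_le
  obtain ⟨y, hy⟩ := hrefl Φ
  -- The formal sum of the unit vectors would be the constant `1`, which does not vanish at
  -- infinity.
  have hone : ∀ i, y i = 1 := fun i => by
    rw [← ZeroAtInftyContinuousMap.coord_apply, ← NormedSpace.dual_def ℝ, hy, hΦ]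
    simp [ZeroAtInftyContinuousMap.coord_apply, ZeroAtInftyContinuousMap.unitVector_apply]
  have hlim := y.zero_at_infty'
  rw [Filter.cocompact_eq_cofinite] at hlim
  exact one_ne_zero (tendsto_nhds_unique
    (tendsto_const_nhds.congr fun i => (hone i).symm) hlim)

theorem SuperReflexive.exists_not_signPackable {X : Type*} [NormedAddCommGroup X]
    [NormedSpace ℝ X] (hX : SuperReflexive X) {ε : ℝ} (hε : 0 < ε) :
    ∃ n, ¬ SignPackable X ε (Fin n) := by
  by_contra! h
  exact not_isReflexiveSpace_zeroAtInfty
    (hX C₀(ULift ℕ, ℝ) (finitelyRepresentable_zeroAtInfty hε h))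

end CZero

/-! ### The packing number as supremum of the cotypes. -/

section Cotype

variable {X : Type*} [NormedAddCommGroup X] [NormedSpace ℝ X] {ι : Type} [Fintype ι]
  [DecidableEq ι]

/-- Replacing each vector by `mᵢ` copies of its `mᵢ`-th part does not increase the average. -/
theorem signAverage_split_le (m : ι → ℕ) (x : ι → X) :
    signAverage (fun p : Σ i, Fin (m i) => (m p.1 : ℝ)⁻¹ • x p.1) ≤ signAverage x := by
  -- Randomizing the signs further, block by block, turns the split family into the original one
  -- with coefficients equal to block means of signs, to which contraction applies.
  set a : ((Σ i, Fin (m i)) → ℤˣ) → ι → ℝ :=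
    fun σ i => (m i : ℝ)⁻¹ * ∑ j, ((σ ⟨i, j⟩ : ℤ) : ℝ) with ha
  have ha1 : ∀ σ i, |a σ i| ≤ 1 := fun σ i => by
    simp only [ha]
    rw [abs_mul, abs_of_nonneg (by positivity : (0 : ℝ) ≤ (m i : ℝ)⁻¹)]
    refine inv_mul_le_one_of_le₀ ((Finset.abs_sum_le_sum_abs _ _).trans (le_of_eq ?_))
      (Nat.cast_nonneg _)
    simp [abs_cast_sign]
  have hτ : ∀ τ : ι → ℤˣ, signAverage (fun p : Σ i, Fin (m i) => (m p.1 : ℝ)⁻¹ • x p.1)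
      = 𝔼 σ, ‖signSum (fun i => a σ i • x i) τ‖ := fun τ => by
    unfold signAverage
    rw [← expect_sign_mul_right _ fun p => τ p.1]
    refine Finset.expect_congr rfl fun σ _ => ?_
    congr 1
    simp only [signSum, Fintype.sum_sigma, ha, smul_smul, ← Finset.sum_smul, Finset.mul_sum,
      Pi.mul_apply]
    refine Finset.sum_congr rfl fun i _ => ?_
    congr 1
    refine Finset.sum_congr rfl fun j _ => ?_
    push_cast
    ring
  calc signAverage (fun p : Σ i, Fin (m i) => (m p.1 : ℝ)⁻¹ • x p.1)
      = 𝔼 τ : ι → ℤˣ, 𝔼 σ, ‖signSum (fun i => a σ i • x i) τ‖ := by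
        rw [← Finset.expect_congr rfl fun τ _ => hτ τ, Fintype.expect_const]
    _ = 𝔼 σ, signAverage (fun i => a σ i • x i) := Finset.expect_comm _ _ _
    _ ≤ 𝔼 _σ : (Σ i, Fin (m i)) → ℤˣ, signAverage x :=
        Finset.expect_le_expect fun σ _ => signAverage_smul_le x (ha1 σ)
    _ = signAverage x := Fintype.expect_const _

theorem sum_le_of_forall_fin {φ : ℝ → ℝ} {a b : ℝ}
    (h : ∀ (n : ℕ) (x : Fin n → X), (∀ k, ‖x k‖ ≤ 1) → rademacherAverage x ≤ a → ∑ k, φ ‖x k‖ ≤ b)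
    (x : ι → X) (hx1 : ∀ i, ‖x i‖ ≤ 1) (hx : signAverage x ≤ a) : ∑ i, φ ‖x i‖ ≤ b := by
  let e := (Fintype.equivFin ι).symm
  have := h _ (x ∘ e) (fun k => hx1 _) (by rwa [rademacherAverage_eq_signAverage,
    signAverage_comp_equiv])
  rwa [← e.sum_comp]

/-- A cotype with constants `a`, `b` is controlled by the sign packing numbers at a comparable
scale: it is dominated at `ε` by a truncated affine, hence convex, cotype. -/
theorem SignPackable.card_mul_le {φ : ℝ → ℝ} {a b ε : ℝ} (ha : 0 < a) (ha1 : a ≤ 1) (hb : 0 < b)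
    (hε : 0 < ε) (hnonneg : ∀ t ∈ Icc (0 : ℝ) 1, 0 ≤ φ t) (hmono : MonotoneOn φ (Icc 0 1))
    (hε1 : ε ≤ 1)
    (h : ∀ (n : ℕ) (x : Fin n → X), (∀ k, ‖x k‖ ≤ 1) → rademacherAverage x ≤ a → ∑ k, φ ‖x k‖ ≤ b)
    (hp : SignPackable X (2 * ε / a) ι) : Fintype.card ι * φ ε ≤ b := by
  have hφε : 0 ≤ φ ε := hnonneg ε ⟨hε.le, hε1⟩
  -- `a • x i` can be cut into `⌊a / ε * ‖x i‖⌋₊` pieces of norm at least `ε`, and this count is at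
  -- least `a / ε * ‖x i‖ - 1`. So `ψ` satisfies the normalized inequality, and at `2 * ε / a` the
  -- truncated factor equals `1`.
  set ψ : ℝ → ℝ := fun t => (φ ε / b) * max (a / ε * t + -1) 0 with hψ
  have hconv : ConvexOn ℝ (Icc 0 1) ψ :=
    ((((LinearMap.mulLeft ℝ (a / ε)).convexOn (convex_Icc 0 1)).add_const (-1)).sup
      (convexOn_const 0 (convex_Icc 0 1))).smul (div_nonneg hφε hb.le)
  have hψmono : MonotoneOn ψ (Icc 0 1) := fun s _ t _ hst => by
    simp only [hψ]
    gcongr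
  have hmain := hp.card_mul_le_one (by positivity) hψmono hconv fun x hx => by
    set m : ι → ℕ := fun i => ⌊a / ε * ‖x i‖⌋₊ with hm
    have hy := (signAverage_split_le m fun i => a • x i).trans_eq (signAverage_smul a x)
    rw [abs_of_pos ha] at hy
    have hya := hy.trans (mul_le_of_le_one_right ha.le hx)
    have hnorm1 := fun p => (norm_le_signAverage _ p).trans (hya.trans ha1)
    have hsum := sum_le_of_forall_fin h _ hnorm1 hya
    have hge : ∀ p : Σ i, Fin (m i), φ ε ≤ φ ‖(m p.1 : ℝ)⁻¹ • a • x p.1‖ := fun p => by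
      refine hmono ⟨hε.le, hε1⟩ ⟨norm_nonneg _, hnorm1 p⟩ ?_
      have hpos : (0 : ℝ) < m p.1 := Nat.cast_pos.mpr p.2.pos
      have hfloor : (m p.1 : ℝ) ≤ a / ε * ‖x p.1‖ := Nat.floor_le (by positivity)
      rw [norm_smul, norm_smul, Real.norm_of_nonneg (inv_pos.mpr hpos).le,
        Real.norm_of_nonneg ha.le, le_inv_mul_iff₀ hpos]
      calc (m p.1 : ℝ) * ε ≤ a / ε * ‖x p.1‖ * ε := mul_le_mul_of_nonneg_right hfloor hε.le
        _ = a * ‖x p.1‖ := by field_simp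
    have hcount : ∑ i, (m i : ℝ) * φ ε ≤ b := by
      refine le_trans ?_ hsum
      rw [Fintype.sum_sigma]
      refine Finset.sum_le_sum fun i _ => ?_
      calc (m i : ℝ) * φ ε = ∑ _j : Fin (m i), φ ε := by simp
        _ ≤ _ := Finset.sum_le_sum fun j _ => hge ⟨i, j⟩
    calc ∑ i, ψ ‖x i‖ ≤ ∑ i, b⁻¹ * ((m i : ℝ) * φ ε) := by
          refine Finset.sum_le_sum fun i _ => ?_
          have hmax : max (a / ε * ‖x i‖ + -1) 0 ≤ m i := by
            refine max_le ?_ (Nat.cast_nonneg _)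
            have := (Nat.lt_floor_add_one (a / ε * ‖x i‖)).le
            simp only [hm]
            linarith
          calc ψ ‖x i‖ ≤ φ ε / b * m i :=
                mul_le_mul_of_nonneg_left hmax (div_nonneg hφε hb.le)
            _ = _ := by ring
      _ = b⁻¹ * ∑ i, (m i : ℝ) * φ ε := by rw [Finset.mul_sum]
      _ ≤ 1 := inv_mul_le_one_of_le₀ hcount hb.le
  have hval : ψ (2 * ε / a) = φ ε / b := by
    have h1 : a / ε * (2 * ε / a) = 2 := by field_simp
    simp only [hψ, h1]
    norm_num
  rwa [hval, mul_div_assoc', div_le_one hb] at hmain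

variable (X) in
/-- The least number of vectors of norm at least `ε` which cannot be found in any `ℓ¹(Ω; X)` with
sign average at most `1`. -/
noncomputable def signPackingNumber (ε : ℝ) : ℕ := sInf {n | ¬ SignPackable X ε (Fin n)}

theorem signPackable_of_lt {ε : ℝ} {n : ℕ} (h : n < signPackingNumber X ε) :
    SignPackable X ε (Fin n) := by
  simpa using Nat.notMem_of_lt_sInf h

variable {ε s t : ℝ}

theorem SuperReflexive.not_signPackable (hX : SuperReflexive X) (hε : 0 < ε) :
    ¬ SignPackable X ε (Fin (signPackingNumber X ε)) :=
  Nat.sInf_mem (s := {n | ¬ SignPackable X ε (Fin n)}) (hX.exists_not_signPackable hε)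

theorem SuperReflexive.signPackingNumber_pos (hX : SuperReflexive X) (hε : 0 < ε) :
    0 < signPackingNumber X ε := by
  rw [Nat.pos_iff_ne_zero]
  intro h0
  have := hX.not_signPackable hε
  rw [h0] at this
  exact this (SignPackable.of_vectors (x := fun i => i.elim0)
    (by simp [signAverage, signSum]) fun i => i.elim0)

theorem SuperReflexive.signPackingNumber_anti (hX : SuperReflexive X) (hs : 0 < s) (hst : s ≤ t) :
    signPackingNumber X t ≤ signPackingNumber X s :=
  Nat.sInf_le fun h => hX.not_signPackable hs (h.anti hst)

theorem SuperReflexive.signPackingNumber_mul_le (hX : SuperReflexive X) (hs : 0 < s) (ht : 0 < t) :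
    signPackingNumber X (s * t) ≤ signPackingNumber X s * signPackingNumber X t :=
  Nat.sInf_le fun h => hX.not_signPackable hs <|
    (h.of_injective finProdFinEquiv.injective).of_prod hs (hX.not_signPackable ht)

theorem sum_step_le_one (hX : SuperReflexive X) (hε : 0 < ε) {n : ℕ} (x : Fin n → X)
    (hx : rademacherAverage x ≤ 1) :
    ∑ k, (if ε ≤ ‖x k‖ then ((signPackingNumber X ε : ℝ))⁻¹ else 0) ≤ 1 := by
  rw [rademacherAverage_eq_signAverage] at hx
  rw [← Finset.sum_filter, Finset.sum_const, nsmul_eq_mul]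
  refine mul_inv_le_one_of_le₀ ?_ (Nat.cast_nonneg _)
  rw [Nat.cast_le]
  by_contra! hlt
  set A := Finset.univ.filter fun k => ε ≤ ‖x k‖ with hA
  refine hX.not_signPackable hε (SignPackable.of_le hlt.le ?_)
  have hmem : ∀ i, ε ≤ ‖x (A.equivFin.symm i)‖ := fun i =>
    (Finset.mem_filter.mp (A.equivFin.symm i).2).2
  exact SignPackable.of_vectors (x := fun i => x (A.equivFin.symm i))
    ((signAverage_comp_le (e := fun i => (A.equivFin.symm i : Fin n))
      (Subtype.val_injective.comp A.equivFin.symm.injective) x).trans hx) hmem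

theorem monotone_step {c : ℝ} (hc : 0 ≤ c) : Monotone fun t : ℝ => if ε ≤ t then c else 0 := by
  intro s t hst
  beta_reduce
  split_ifs with h1 h2
  · exact le_rfl
  · exact absurd (h1.trans hst) h2
  · exact hc
  · exact le_rfl

theorem isNormalizedCotype_step (hX : SuperReflexive X) (hε : 0 < ε) :
    IsNormalizedCotype X fun t => if ε ≤ t then ((signPackingNumber X ε : ℝ))⁻¹ else 0 :=
  ⟨⟨fun t _ => by
    beta_reduce
    split_ifs <;> positivity, (monotone_step (by positivity)).monotoneOn _,
    1, 1, one_pos, one_pos, fun _ x _ hx => sum_step_le_one hX hε x hx⟩,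
    fun _ x hx => sum_step_le_one hX hε x hx⟩

/-- `SignPackable.card_mul_le` bounds `φ ε` at scale `2 * ε / a`; the factor `signPackingNumber X (a
/ 2)` brings the scale back to `ε`. For `ε > a / 2` monotonicity suffices. -/
theorem IsCotype.preceq_inv_signPackingNumber (hX : SuperReflexive X) {φ : ℝ → ℝ}
    (hφ : IsCotype X φ) : Preceq φ fun t => ((signPackingNumber X t : ℝ))⁻¹ := by
  obtain ⟨hnonneg, hmono, a', b, ha', hb, hsum'⟩ := hφ
  obtain ⟨a, ha, ha1, haa'⟩ : ∃ a : ℝ, 0 < a ∧ a ≤ 1 ∧ a ≤ a' :=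
    ⟨min a' 1, by positivity, min_le_right _ _, min_le_left _ _⟩
  have hsum : ∀ (n : ℕ) (x : Fin n → X), (∀ k, ‖x k‖ ≤ 1) → rademacherAverage x ≤ a →
      ∑ k, φ ‖x k‖ ≤ b := fun n x hx h => hsum' n x hx (h.trans haa')
  have hφ1 : 0 ≤ φ 1 := hnonneg 1 (by simp)
  have hQa : (0 : ℝ) < signPackingNumber X (a / 2) :=
    Nat.cast_pos.mpr (hX.signPackingNumber_pos (by positivity))
  refine ⟨signPackingNumber X (a / 2) * (b + φ 1), by positivity, fun ε hε => ?_⟩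
  have hQ : (0 : ℝ) < signPackingNumber X ε := Nat.cast_pos.mpr (hX.signPackingNumber_pos hε.1)
  have hφε : 0 ≤ φ ε := hnonneg ε ⟨hε.1.le, hε.2⟩
  have hφle : φ ε ≤ φ 1 := hmono ⟨hε.1.le, hε.2⟩ (by simp) hε.2
  rw [← div_eq_mul_inv, le_div_iff₀ hQ]
  rcases le_or_gt ε (a / 2) with hle | hlt
  · have h2 : 0 < 2 * ε / a := div_pos (mul_pos two_pos hε.1) ha
    have hprod : (signPackingNumber X ε : ℝ)
        ≤ signPackingNumber X (a / 2) * signPackingNumber X (2 * ε / a) := by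
      have := hX.signPackingNumber_mul_le (show 0 < a / 2 by positivity) h2
      rw [show a / 2 * (2 * ε / a) = ε by field_simp] at this
      exact_mod_cast this
    have hpos := hX.signPackingNumber_pos h2
    -- Only one vector fewer than the packing number is packable; the missing `φ ε` is bounded by `φ
    -- 1`.
    have hpack := (signPackable_of_lt (Nat.pred_lt hpos.ne')).card_mul_le ha ha1 hb hε.1
      hnonneg hmono hε.2 hsum
    rw [Fintype.card_fin, Nat.pred_eq_sub_one, Nat.cast_pred hpos] at hpack
    calc φ ε * signPackingNumber X ε
        ≤ φ ε * (signPackingNumber X (a / 2) * signPackingNumber X (2 * ε / a)) :=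
          mul_le_mul_of_nonneg_left hprod hφε
      _ = signPackingNumber X (a / 2) * ((signPackingNumber X (2 * ε / a) - 1) * φ ε + φ ε) := by
          ring
      _ ≤ _ := mul_le_mul_of_nonneg_left (add_le_add hpack hφle) hQa.le
  · have hanti : (signPackingNumber X ε : ℝ) ≤ signPackingNumber X (a / 2) :=
      Nat.cast_le.mpr (hX.signPackingNumber_anti (by positivity) hlt.le)
    calc φ ε * signPackingNumber X ε ≤ φ 1 * signPackingNumber X (a / 2) :=
          mul_le_mul hφle hanti hQ.le hφ1
      _ ≤ _ := by
          rw [mul_comm]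
          exact mul_le_mul_of_nonneg_left (by linarith) hQa.le

theorem geometric_step_nonneg (t : ℕ → ℝ) (k : ℕ) (u : ℝ) : 0 ≤ (1 / 2 : ℝ) ^ k *
    if t k ≤ u then ((signPackingNumber X (t k) : ℝ))⁻¹ else 0 :=
  mul_nonneg (by positivity) (by split_ifs <;> positivity)

theorem summable_geometric_step (hX : SuperReflexive X) {t : ℕ → ℝ} (ht : ∀ k, 0 < t k) (u : ℝ) :
    Summable fun k => (1 / 2 : ℝ) ^ k *
      if t k ≤ u then ((signPackingNumber X (t k) : ℝ))⁻¹ else 0 :=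
  Summable.of_nonneg_of_le (fun k => geometric_step_nonneg t k u) (fun k => by
    refine mul_le_of_le_one_right (by positivity) ?_
    split_ifs
    · exact inv_le_one_of_one_le₀ (by exact_mod_cast hX.signPackingNumber_pos (ht k))
    · exact zero_le_one) summable_geometric_two

theorem isCotype_tsum_step (hX : SuperReflexive X) {t : ℕ → ℝ} (ht : ∀ k, 0 < t k) :
    IsCotype X fun u => ∑' k, (1 / 2 : ℝ) ^ k *
      if t k ≤ u then ((signPackingNumber X (t k) : ℝ))⁻¹ else 0 := by
  have hsummable := summable_geometric_step hX ht
  refine ⟨fun u _ => tsum_nonneg fun k => geometric_step_nonneg t k u, fun u _ v _ huv =>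
    (hsummable u).tsum_le_tsum (fun k => ?_) (hsummable v), 1, 2, one_pos, two_pos,
    fun n x _ hx => ?_⟩
  · exact mul_le_mul_of_nonneg_left (monotone_step (by positivity) huv) (by positivity)
  · rw [← Summable.tsum_finsetSum fun i _ => hsummable ‖x i‖]
    refine le_trans ?_ tsum_geometric_two.le
    refine Summable.tsum_le_tsum (fun k => ?_) (summable_sum fun i _ => hsummable ‖x i‖)
      summable_geometric_two
    rw [← Finset.mul_sum]
    exact mul_le_of_le_one_right (by positivity) (sum_step_le_one hX (ht k) x hx)

/-- If the claim fails, it fails at points `t k` with factor `4 ^ k`. The steps at `t k` with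
weights `2⁻ᵏ` sum to a single cotype, which still exceeds `χ (t k)` by the factor `2 ^ k`. -/
theorem preceq_of_forall_isCotype (hX : SuperReflexive X) {χ : ℝ → ℝ}
    (hχ : ∀ φ, IsCotype X φ → Preceq φ χ) :
    Preceq (fun t => ((signPackingNumber X t : ℝ))⁻¹) χ := by
  by_contra hcon
  unfold Preceq at hcon
  push Not at hcon
  choose t ht hlt using fun k : ℕ => hcon (4 ^ k) (by positivity)
  have hcot := isCotype_tsum_step hX fun k => (ht k).1
  obtain ⟨c, hc, hle⟩ := hχ _ hcot
  obtain ⟨k, hk⟩ := pow_unbounded_of_one_lt c (one_lt_two (α := ℝ))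
  have hQ : (0 : ℝ) < ((signPackingNumber X (t k) : ℝ))⁻¹ :=
    inv_pos.mpr (Nat.cast_pos.mpr (hX.signPackingNumber_pos (ht k).1))
  have hterm : (1 / 2 : ℝ) ^ k * ((signPackingNumber X (t k) : ℝ))⁻¹ ≤ c * χ (t k) := by
    have h := (summable_geometric_step hX (fun k => (ht k).1) (t k)).le_tsum k
      fun j _ => geometric_step_nonneg t j (t k)
    rw [if_pos le_rfl] at h
    exact h.trans (hle (t k) (ht k))
  have hχpos : 0 < χ (t k) := by
    have : 0 < c * χ (t k) := lt_of_lt_of_le (by positivity) hterm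
    exact (pos_iff_pos_of_mul_pos this).mp hc
  have h1 : (2 : ℝ) ^ k * χ (t k) < c * χ (t k) := by
    refine lt_of_lt_of_le ?_ hterm
    have h2 : (2 : ℝ) ^ k = (1 / 2) ^ k * 4 ^ k := by
      rw [← mul_pow]; norm_num
    rw [h2, mul_assoc]
    exact mul_lt_mul_of_pos_left (hlt k) (by positivity)
  exact absurd (lt_of_mul_lt_mul_right h1 hχpos.le) hk.not_gt

theorem iSup_convex_normalizedCotype_le (hX : SuperReflexive X) (ht : t ∈ Ioc (0 : ℝ) 1) :
    (⨆ (φ : ℝ → ℝ) (_ : IsNormalizedCotype X φ ∧ ConvexOn ℝ (Icc 0 1) φ), ENNReal.ofReal (φ t))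
      ≤ (ENNReal.ofReal (signPackingNumber X t - 1))⁻¹ := by
  refine iSup₂_le fun φ ⟨⟨⟨hnonneg, hmono, _⟩, hnorm⟩, hconv⟩ => ?_
  have hpos := hX.signPackingNumber_pos ht.1
  have h := (signPackable_of_lt (Nat.pred_lt hpos.ne')).card_mul_le_one ht.1.le hmono hconv
    fun x hx => hnorm _ x (by rwa [rademacherAverage_eq_signAverage])
  rw [Fintype.card_fin, Nat.pred_eq_sub_one, Nat.cast_pred hpos, mul_comm] at h
  rw [ENNReal.le_inv_iff_mul_le, ← ENNReal.ofReal_mul (hnonneg t ⟨ht.1.le, ht.2⟩)]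
  exact ENNReal.ofReal_le_one.mpr h

end Cotype

theorem theorem1p4 {X : Type*} [NormedAddCommGroup X] [NormedSpace ℝ X] [CompleteSpace X]
    (hX : SuperReflexive X) :
    ∃ Q : ℝ → ℝ,
      (∀ t ∈ Set.Ioc (0 : ℝ) 1, 0 < Q t) ∧
      AntitoneOn Q (Set.Ioc 0 1) ∧
      (∀ s ∈ Set.Ioc (0 : ℝ) 1, ∀ t ∈ Set.Ioc (0 : ℝ) 1, Q (s * t) ≤ Q s * Q t) ∧
      (∀ t ∈ Set.Ioc (0 : ℝ) 1,
        (⨆ (φ : ℝ → ℝ) (_ : IsNormalizedCotype X φ ∧ ConvexOn ℝ (Set.Icc 0 1) φ),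
          ENNReal.ofReal (φ t)) ≤ (ENNReal.ofReal (Q t - 1))⁻¹) ∧
      (∀ ε ∈ Set.Ioc (0 : ℝ) 1,
        IsNormalizedCotype X (fun t => if ε ≤ t then (Q ε)⁻¹ else 0)) ∧
      IsPreceqSup {φ | IsCotype X φ} (fun t => (Q t)⁻¹) := by
  refine ⟨fun t => signPackingNumber X t,
    fun t ht => Nat.cast_pos.mpr (hX.signPackingNumber_pos ht.1),
    fun s hs t _ hst => Nat.cast_le.mpr (hX.signPackingNumber_anti hs.1 hst),
    fun s hs t ht => ?_, fun t ht => iSup_convex_normalizedCotype_le hX ht,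
    fun ε hε => isNormalizedCotype_step hX hε.1,
    fun φ hφ => hφ.preceq_inv_signPackingNumber hX, fun χ hχ => preceq_of_forall_isCotype hX hχ⟩
  beta_reduce
  exact_mod_cast hX.signPackingNumber_mul_le hs.1 ht.1
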